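/- A pseudo hoop is an algebra $(A;\cdot,\to,\rightsquigarrow,1)$ such that for all $x,y,z\in A$: $x\cdot 1=x=1\cdot x$; $x\to x=1=x\rightsquigarrow x$; $(x\cdot y)\to z=x\to(y\to z)$; $(x\cdot y)\rightsquigarrow z=y\rightsquigarrow(x\rightsquigarrow z)$; and $(x\to y)\cdot x=(y\to x)\cdot y=x\cdot(x\rightsquigarrow y)=y\cdot(y\rightsquigarrow x)$. It is ordered by $x\le y$ iff $x\to y=1$, and its multiplication is associative. It is basic if $(x\to y)\to z\le((y\to x)\to z)\to z$ and $(x\rightsquigarrow y)\rightsquigarrow z\le((y\rightsquigarrow x)\rightsquigarrow z)\rightsquigarrow z$ for all $x,y,z\in A$. A filter is a non-empty subset $F\subseteq A$ that is closed under $\cdot$ and upward closed; it is maximal if it is proper and not properly contained in any proper filter, and normal if, for all $x,y\in A$, $x\to y\in F$ iff $x\rightsquigarrow y\in F$. An element $u\in A$ is a strong unit if the filter generated by $u$ is $A$. Powers and products bind more strongly than $\to$ and $\rightsquigarrow$, and $\prod_{i=1}^n x_i=x_1x_2\cdots x_n$ in this order. **Theorem.** Let $A$ be a basic pseudo hoop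 with a fixed strong unit $u$. Then every maximal filter of $A$ is normal if and only if the following three conditions hold: (i) $\Big(\big(\prod_{i=1}^n x_i\big)\to u\Big)^2\le\Big(\prod_{i=1}^n x_{\pi(i)}^2\Big)\to u$ for all $n\in\mathbb N$, all $x_1,\dots,x_n\in A$ and every permutation $\pi$ of $\{1,\dots,n\}$; (ii) $\big((x\to y)^n\to u\big)^2\le (x\rightsquigarrow y)^{2n}\to u$ for all $n\in\mathbb N$ and $x,y\in A$; (iii) $\big((x\rightsquigarrow y)^n\to u\big)^2\le (x\to y)^{2n}\to u$ for all $n\in\mathbb N$ and $x,y\in A$. -/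

import Mathlib

/-- The operations of a pseudo hoop: multiplication `*`, unit `1`, and two residuals. -/
class PseudoHoopOps (A : Type*) extends Mul A, One A where
  /-- the residual written `→` in the literature -/
  limp : A → A → A
  /-- the residual written `⇝` in the literature -/
  rimp : A → A → A

infixr:60 " ⇾ " => PseudoHoopOps.limp
infixr:60 " ⇝ " => PseudoHoopOps.rimp

/-- A pseudo hoop. -/
class PseudoHoop (A : Type*) extends PseudoHoopOps A where
  hoop_mul_one : ∀ x : A, x * 1 = x
  hoop_one_mul : ∀ x : A, 1 * x = x
  limp_self : ∀ x : A, x ⇾ x = 1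
  rimp_self : ∀ x : A, x ⇝ x = 1
  mul_limp : ∀ x y z : A, (x * y) ⇾ z = x ⇾ (y ⇾ z)
  mul_rimp : ∀ x y z : A, (x * y) ⇝ z = y ⇝ (x ⇝ z)
  limp_mul_comm : ∀ x y : A, (x ⇾ y) * x = (y ⇾ x) * y
  limp_mul_eq_mul_rimp : ∀ x y : A, (y ⇾ x) * y = x * (x ⇝ y)
  mul_rimp_comm : ∀ x y : A, x * (x ⇝ y) = y * (y ⇝ x)

namespace PseudoHoop

/-- The natural order: `x ≤ y` iff `x ⇾ y = 1`. -/
instance instLE (A : Type*) [PseudoHoop A] : LE A := ⟨fun x y => x ⇾ y = 1⟩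

theorem eq_of_limp {A : Type*} [PseudoHoop A] {x y : A}
    (h₁ : x ⇾ y = 1) (h₂ : y ⇾ x = 1) : x = y := by
  have h := limp_mul_comm x y
  rwa [h₁, h₂, hoop_one_mul, hoop_one_mul] at h

theorem hoop_mul_assoc {A : Type*} [PseudoHoop A] (x y z : A) :
    x * y * z = x * (y * z) := by
  have key : ∀ w : A, (x * y * z) ⇾ w = (x * (y * z)) ⇾ w := fun w => by
    simp only [mul_limp]
  apply eq_of_limp
  · rw [key, limp_self]
  · rw [← key, limp_self]

/-- The underlying monoid of a pseudo hoop (associativity is a consequence of the axioms);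
it provides the powers `x ^ n` and the ordered products `List.prod`. -/
instance instMonoid (A : Type*) [PseudoHoop A] : Monoid A where
  mul_assoc := hoop_mul_assoc
  one_mul := hoop_one_mul
  mul_one := hoop_mul_one

/-- A filter: a nonempty subset closed under multiplication and upwards closed. -/
structure IsFilter {A : Type*} [PseudoHoop A] (F : Set A) : Prop where
  nonempty : F.Nonempty
  mul_mem : ∀ x y : A, x ∈ F → y ∈ F → x * y ∈ F
  mem_of_le : ∀ x y : A, x ≤ y → x ∈ F → y ∈ F

/-- A maximal filter: a proper filter not properly contained in any proper filter. -/
structure IsMaximalFilter {A : Type*} [PseudoHoop A] (F : Set A) : Prop where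
  isFilter : IsFilter F
  ne_univ : F ≠ Set.univ
  not_ssubset : ∀ G : Set A, IsFilter G → G ≠ Set.univ → ¬ F ⊂ G

/-- A normal filter: `x ⇾ y ∈ F` iff `x ⇝ y ∈ F`. -/
structure IsNormalFilter {A : Type*} [PseudoHoop A] (F : Set A) : Prop where
  isFilter : IsFilter F
  limp_mem_iff : ∀ x y : A, x ⇾ y ∈ F ↔ x ⇝ y ∈ F

/-- The filter generated by a subset: the intersection of all filters containing it. -/
def generatedFilter {A : Type*} [PseudoHoop A] (S : Set A) : Set A :=
  ⋂₀ {F : Set A | IsFilter F ∧ S ⊆ F}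

/-- A strong unit: an element that generates the whole algebra as a filter. -/
def IsStrongUnit {A : Type*} [PseudoHoop A] (u : A) : Prop :=
  generatedFilter ({u} : Set A) = Set.univ

end PseudoHoop

/-- A basic pseudo hoop. -/
class BasicPseudoHoop (A : Type*) extends PseudoHoop A where
  basic_limp : ∀ x y z : A, (x ⇾ y) ⇾ z ≤ ((y ⇾ x) ⇾ z) ⇾ z
  basic_rimp : ∀ x y z : A, (x ⇝ y) ⇝ z ≤ ((y ⇝ x) ⇝ z) ⇝ z

/-! Suppose all maximal filters are normal and one of the inequalities fails. A linear filter `F`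
then misses the offending element (`exists_isLinearFilter_notMem`) and extends to a maximal, hence
normal, filter `V` with `u ∉ V`. Modulo `V` the algebra is totally ordered and archimedean, so
`exists_isScale` measures each `x` by the least exponent `N x` with `e ^ N x ≤ x`, up to an error
`δ` small against `N u`. Sums of exponents ignore the order of factors, and swapping the residuals
shifts `N` by at most `δ`. Squaring makes the exponents of the product in question sum to about `2 *
N u` or more. This surplus over `N u` absorbs all errors and, by `list_prod_limp_mem`, puts the
product below `u` modulo `F` itself, although `F` need not be normal: a contradiction.

Conversely, if `b ∉ V` with `V` maximal, some product of elements of `V` and copies of `b` lies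
below `u`. Condition (i) collects the copies of `b`, so `b ^ (2 * n) ⇾ u ∈ V`; (ii) or (iii)
replaces `b` by the other residual `a`, and `a ∈ V` would force `u ∈ V`. -/

namespace PseudoHoop

/-! ### Order and residuation -/

section Order

variable {A : Type*} [PseudoHoop A]

theorem one_limp (x : A) : 1 ⇾ x = x := by
  apply eq_of_limp
  · have h := limp_self (1 ⇾ x)
    rwa [← mul_limp, hoop_mul_one] at h
  · rw [← mul_limp, hoop_mul_one, limp_self]

theorem one_rimp (x : A) : 1 ⇝ x = x := by
  have h := limp_mul_eq_mul_rimp 1 x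
  rw [← limp_mul_comm, hoop_mul_one, hoop_one_mul, one_limp] at h
  exact h.symm

theorem limp_one (x : A) : x ⇾ 1 = 1 := by
  have h := limp_self (x ⇾ (1 : A))
  rwa [← mul_limp, limp_mul_comm, hoop_mul_one, one_limp] at h

theorem rimp_one (x : A) : x ⇝ 1 = 1 := by
  have h := rimp_self (x ⇝ (1 : A))
  rwa [← mul_rimp, mul_rimp_comm, hoop_one_mul, one_rimp] at h

theorem le_def {x y : A} : x ≤ y ↔ x ⇾ y = 1 := Iff.rfl

instance instPartialOrder : PartialOrder A where
  __ := instLE A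
  le_refl := limp_self
  le_trans x y z hxy hyz := by
    have hx := limp_mul_comm x y
    rw [le_def.1 hxy, hoop_one_mul] at hx
    rw [le_def, hx, mul_limp, le_def.1 hyz, limp_one]
  le_antisymm _ _ := eq_of_limp

theorem le_one_hoop (x : A) : x ≤ 1 := limp_one x

theorem one_le_iff {x : A} : 1 ≤ x ↔ x = 1 := by rw [le_def, one_limp]

theorem mul_le_right_hoop (x y : A) : x * y ≤ y := by
  rw [le_def, mul_limp, limp_self, limp_one]

theorem le_iff_rimp {x y : A} : x ≤ y ↔ x ⇝ y = 1 := by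
  constructor
  · intro h
    have hx : x = y * (y ⇝ x) := by
      rw [← mul_rimp_comm, ← limp_mul_eq_mul_rimp, ← limp_mul_comm, le_def.1 h, hoop_one_mul]
    rw [hx, mul_rimp, rimp_self, rimp_one]
  · intro h
    have hx := limp_mul_eq_mul_rimp x y
    rw [h, hoop_mul_one] at hx
    rw [← hx]
    exact mul_le_right_hoop _ _

theorem le_limp_iff {x y z : A} : x ≤ y ⇾ z ↔ x * y ≤ z := by
  rw [le_def, le_def, mul_limp]

theorem le_rimp_iff {x y z : A} : y ≤ x ⇝ z ↔ x * y ≤ z := by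
  rw [le_iff_rimp, le_iff_rimp, mul_rimp]

theorem mul_le_left_hoop (x y : A) : x * y ≤ x := by
  rw [le_iff_rimp, mul_rimp, rimp_self, rimp_one]

instance instMulLeftMono : MulLeftMono A :=
  ⟨fun _ _ _ h => le_rimp_iff.1 (h.trans (le_rimp_iff.2 le_rfl))⟩

instance instMulRightMono : MulRightMono A :=
  ⟨fun _ _ _ h => le_limp_iff.1 (h.trans (le_limp_iff.2 le_rfl))⟩

theorem limp_mul_le (x y : A) : (x ⇾ y) * x ≤ y := le_limp_iff.1 le_rfl

theorem mul_rimp_le (x y : A) : x * (x ⇝ y) ≤ y := le_rimp_iff.1 le_rfl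

theorem le_limp (x y : A) : y ≤ x ⇾ y := le_limp_iff.2 (mul_le_left_hoop _ _)

end Order

/-! ### Filters -/

section Filter

variable {A : Type*} [PseudoHoop A] {F V : Set A}

theorem IsFilter.one_mem (hF : IsFilter F) : (1 : A) ∈ F := by
  obtain ⟨x, hx⟩ := hF.nonempty
  exact hF.mem_of_le x 1 (le_one_hoop x) hx

theorem IsFilter.mp (hF : IsFilter F) {x y : A} (hxy : x ⇾ y ∈ F) (hx : x ∈ F) : y ∈ F :=
  hF.mem_of_le _ _ (limp_mul_le x y) (hF.mul_mem _ _ hxy hx)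

theorem IsFilter.limp_mem (hF : IsFilter F) {x y : A} (hy : y ∈ F) : x ⇾ y ∈ F :=
  hF.mem_of_le _ _ (le_limp x y) hy

theorem IsFilter.pow_mem (hF : IsFilter F) {x : A} (hx : x ∈ F) (n : ℕ) : x ^ n ∈ F := by
  induction n with
  | zero => simpa using hF.one_mem
  | succ n ih => rw [pow_succ]; exact hF.mul_mem _ _ ih hx

theorem IsFilter.list_prod_mem (hF : IsFilter F) {l : List A} (hl : ∀ x ∈ l, x ∈ F) :
    l.prod ∈ F := by
  induction l with
  | nil => simpa using hF.one_mem
  | cons a l ih =>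
    rw [List.prod_cons]
    exact hF.mul_mem _ _ (hl a (by simp)) (ih fun x hx => hl x (by simp [hx]))

theorem IsStrongUnit.eq_univ {u : A} (hu : IsStrongUnit u) (hF : IsFilter F) (h : u ∈ F) :
    F = Set.univ := by
  rw [Set.eq_univ_iff_forall]
  intro x
  have hx : x ∈ generatedFilter ({u} : Set A) := by rw [hu]; trivial
  exact hx F ⟨hF, by simpa using h⟩

/-- Zorn's lemma for filters avoiding an element. -/
theorem IsFilter.exists_maximal_notMem (hF : IsFilter F) {c : A} (hc : c ∉ F) :
    ∃ G : Set A, F ⊆ G ∧ IsFilter G ∧ c ∉ G ∧ ∀ H, IsFilter H → c ∉ H → G ⊆ H → H = G := by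
  obtain ⟨G, hFG, hG⟩ := zorn_subset_nonempty {G : Set A | IsFilter G ∧ c ∉ G}
    (fun C hC hchain hne => by
      refine ⟨⋃₀ C, ⟨⟨?_, ?_, ?_⟩, ?_⟩, fun s hs => Set.subset_sUnion_of_mem hs⟩
      · obtain ⟨s, hs⟩ := hne
        exact ⟨1, s, hs, (hC hs).1.one_mem⟩
      · rintro x y ⟨s, hs, hx⟩ ⟨t, ht, hy⟩
        rcases hchain.total hs ht with h | h
        · exact ⟨t, ht, (hC ht).1.mul_mem _ _ (h hx) hy⟩
        · exact ⟨s, hs, (hC hs).1.mul_mem _ _ hx (h hy)⟩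
      · rintro x y hxy ⟨s, hs, hx⟩
        exact ⟨s, hs, (hC hs).1.mem_of_le _ _ hxy hx⟩
      · rintro ⟨s, hs, hx⟩
        exact (hC hs).2 hx) F ⟨hF, hc⟩
  exact ⟨G, hFG, hG.prop.1, hG.prop.2, fun H hH hcH hGH =>
    (hG.le_of_ge ⟨hH, hcH⟩ hGH).antisymm hGH⟩

theorem IsFilter.exists_isMaximalFilter (hF : IsFilter F) {u : A} (hu : IsStrongUnit u)
    (huF : u ∉ F) : ∃ V : Set A, F ⊆ V ∧ IsMaximalFilter V ∧ u ∉ V := by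
  obtain ⟨V, hFV, hV, huV, hmax⟩ := hF.exists_maximal_notMem huF
  refine ⟨V, hFV, ⟨hV, fun h => huV (h ▸ trivial), fun G hG hne hVG => ?_⟩, huV⟩
  exact hVG.ne (hmax G hG (fun h => hne (hu.eq_univ hG h)) hVG.subset).symm

/-- The elements `z` whose join with `b` belongs to the filter `F`. -/
def joinResidual (F : Set A) (b : A) : Set A :=
  {z | ∃ f ∈ F, ∀ t, z ≤ t → b ≤ t → f ≤ t}

theorem IsFilter.joinResidual (hF : IsFilter F) (b : A) : IsFilter (joinResidual F b) where
  nonempty := ⟨1, 1, hF.one_mem, fun _ h _ => h⟩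
  mul_mem := by
    rintro z z' ⟨f, hf, hz⟩ ⟨f', hf', hz'⟩
    refine ⟨f * f', hF.mul_mem _ _ hf hf', fun t ht hbt => ?_⟩
    have h : f * z' ≤ t :=
      le_limp_iff.1 (hz _ (le_limp_iff.2 ht) (hbt.trans (le_limp _ _)))
    exact le_rimp_iff.1
      (hz' _ (le_rimp_iff.2 h) (le_rimp_iff.2 ((mul_le_right_hoop _ _).trans hbt)))
  mem_of_le := by
    rintro z w hzw ⟨f, hf, hz⟩
    exact ⟨f, hf, fun t ht hbt => hz t (hzw.trans ht) hbt⟩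

theorem subset_joinResidual (F : Set A) (b : A) : F ⊆ joinResidual F b :=
  fun f hf => ⟨f, hf, fun _ h _ => h⟩

end Filter

/-- A filter `F` is linear if the relation `x ⇾ y ∈ F` is total. -/
def IsLinearFilter {A : Type*} [PseudoHoop A] (F : Set A) : Prop :=
  ∀ x y : A, x ⇾ y ∈ F ∨ y ⇾ x ∈ F

/-- A filter maximal among those avoiding `c` behaves like a prime filter. Joins are replaced by
common upper bounds, so no normality is needed. -/
theorem exists_isLinearFilter_notMem {A : Type*} [BasicPseudoHoop A] {c : A} (hc : c ≠ 1) :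
    ∃ F : Set A, IsFilter F ∧ IsLinearFilter F ∧ c ∉ F := by
  have h1 : IsFilter ({1} : Set A) :=
    ⟨⟨1, rfl⟩, by rintro x y rfl rfl; simp, by
      rintro x y hxy rfl; exact one_le_iff.1 hxy⟩
  obtain ⟨F, -, hF, hcF, hmax⟩ := h1.exists_maximal_notMem (c := c) (by simpa using hc)
  have key : ∀ b z, z ∈ joinResidual F b → z ∉ F → c ∈ joinResidual F b := by
    intro b z hz hzF
    by_contra hcb
    rw [← hmax _ (hF.joinResidual b) hcb (subset_joinResidual F b)] at hzF
    exact hzF hz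
  refine ⟨F, hF, fun x y => ?_, hcF⟩
  by_contra! hxy
  -- Basicness: the only common upper bound of `x ⇾ y` and `y ⇾ x` is `1`.
  obtain ⟨f, hf, hfc⟩ := key (y ⇾ x) (x ⇾ y) ⟨1, hF.one_mem, fun t hx hy => by
    have h := BasicPseudoHoop.basic_limp x y t
    rwa [le_def.1 hx, le_def.1 hy, one_limp] at h⟩ hxy.1
  obtain ⟨g, hg, hgc⟩ := key c (y ⇾ x) ⟨f, hf, fun t hy hct => hfc t hct hy⟩ hxy.2
  exact hcF (hF.mem_of_le _ _ (hgc c le_rfl le_rfl) hg)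


/-! ### The preorder modulo a normal filter, and scales -/

section LeMod

variable {A : Type*} [PseudoHoop A]

/-- The preorder on `A` induced by a normal filter `V`: `x ⇾ y ∈ V`. -/
def LeMod (V : Set A) (x y : A) : Prop := x ⇾ y ∈ V

variable {V : Set A}

namespace LeMod

theorem of_le (hV : IsFilter V) {x y : A} (h : x ≤ y) : LeMod V x y := by
  rw [LeMod, le_def.1 h]
  exact hV.one_mem

theorem trans (hV : IsFilter V) {x y z : A} (hxy : LeMod V x y) (hyz : LeMod V y z) :
    LeMod V x z := by
  refine hV.mem_of_le _ _ ?_ (hV.mul_mem _ _ hyz hxy)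
  rw [le_limp_iff, mul_assoc]
  exact (mul_le_mul_right (limp_mul_le x y) _).trans (limp_mul_le y z)

theorem le_trans (hV : IsFilter V) {x y z : A} (hxy : LeMod V x y) (hyz : y ≤ z) :
    LeMod V x z := hxy.trans hV (of_le hV hyz)

theorem limp_iff {x y z : A} : LeMod V x (y ⇾ z) ↔ LeMod V (x * y) z := by
  rw [LeMod, LeMod, mul_limp]

theorem rimp_iff (hV : IsNormalFilter V) {x y z : A} :
    LeMod V y (x ⇝ z) ↔ LeMod V (x * y) z := by
  rw [LeMod, LeMod, hV.limp_mem_iff, hV.limp_mem_iff, mul_rimp]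

theorem mul (hV : IsNormalFilter V) {x y z w : A} (hxy : LeMod V x y) (hzw : LeMod V z w) :
    LeMod V (x * z) (y * w) :=
  trans hV.isFilter
    (limp_iff.1 (hxy.le_trans hV.isFilter (le_limp_iff.2 le_rfl)) : LeMod V (x * z) (y * z))
    ((rimp_iff hV).1 (hzw.le_trans hV.isFilter (le_rimp_iff.2 le_rfl)))

theorem pow (hV : IsNormalFilter V) {x y : A} (hxy : LeMod V x y) (n : ℕ) :
    LeMod V (x ^ n) (y ^ n) := by
  induction n with
  | zero => simpa using of_le hV.isFilter le_rfl
  | succ n ih => simpa only [pow_succ] using ih.mul hV hxy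

/-- If `y ≤ x` modulo `V`, then `y` is below `(x ⇾ y) * x` modulo `V`. -/
theorem limp_mul (hV : IsFilter V) {x y : A} (hyx : LeMod V y x) :
    LeMod V y ((x ⇾ y) * x) := by
  rw [limp_mul_comm]
  exact hV.mem_of_le _ _ (le_limp_iff.2 le_rfl) hyx

end LeMod

theorem pow_anti_hoop (x : A) {m n : ℕ} (h : m ≤ n) : x ^ n ≤ x ^ m := by
  obtain ⟨k, rfl⟩ := Nat.exists_eq_add_of_le h
  rw [pow_add]
  exact mul_le_left_hoop _ _

/-- Modulo a normal maximal filter the powers of an element outside of it are cofinal. -/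
theorem IsMaximalFilter.exists_pow_leMod (hV : IsMaximalFilter V) (hN : IsNormalFilter V)
    {e : A} (he : e ∉ V) (x : A) : ∃ n : ℕ, LeMod V (e ^ n) x := by
  have hf := hV.isFilter
  have hG : IsFilter {z : A | ∃ n : ℕ, LeMod V (e ^ n) z} := by
    refine ⟨⟨e, 1, by simpa using LeMod.of_le hf le_rfl⟩, ?_, ?_⟩
    · rintro x y ⟨m, hm⟩ ⟨n, hn⟩
      exact ⟨m + n, by rw [pow_add]; exact hm.mul hN hn⟩
    · rintro x y hxy ⟨n, hn⟩
      exact ⟨n, hn.le_trans hf hxy⟩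
  by_contra hx
  refine hV.not_ssubset _ hG (fun h => hx (Set.eq_univ_iff_forall.1 h x)) ⟨fun z hz => ?_, fun h => ?_⟩
  · exact ⟨0, hf.limp_mem hz⟩
  · exact he (h ⟨1, by simpa using LeMod.of_le hf le_rfl⟩)

/-- Repeated halving: if `g` is not below `e`, then `e ≤ (g ⇾ e) * g` modulo `V`, so the larger of
the two factors has its square above `e`, and both lie outside `V`. -/
theorem exists_not_pow_leMod (hN : IsNormalFilter V) (htot : IsLinearFilter V)
    (hdense : ∀ e ∉ V, ∃ x ∉ V, ¬ LeMod V x e) {u : A} (huV : u ∉ V) (n : ℕ) :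
    ∃ e ∉ V, ¬ LeMod V (e ^ n) u := by
  have hf := hN.isFilter
  suffices h : ∀ k : ℕ, ∃ e ∉ V, ¬ LeMod V (e ^ 2 ^ k) u by
    obtain ⟨e, he, h⟩ := h n
    exact ⟨e, he, fun h' => h ((LeMod.of_le hf (pow_anti_hoop e Nat.lt_two_pow_self.le)).trans hf h')⟩
  intro k
  induction k with
  | zero => simpa using hdense u huV
  | succ k ih =>
    obtain ⟨e, he, hk⟩ := ih
    obtain ⟨g, hg, hge⟩ := hdense e he
    have hmul : LeMod V e ((g ⇾ e) * g) := LeMod.limp_mul hf ((htot e g).resolve_right hge)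
    have aux : ∀ f, LeMod V (g ⇾ e) f → LeMod V g f → ¬ LeMod V (f ^ 2 ^ (k + 1)) u := by
      intro f h1 h2 h3
      rw [pow_succ', pow_mul, pow_two] at h3
      exact hk (((hmul.trans hf (h1.mul hN h2)).pow hN _).trans hf h3)
    rcases htot (g ⇾ e) g with h | h
    · exact ⟨g, hg, aux g h (LeMod.of_le hf le_rfl)⟩
    · exact ⟨g ⇾ e, hge, aux _ (LeMod.of_le hf le_rfl) h⟩

/-- A scale for the preorder modulo `V`: `N x` is the least `n` with `e ^ n ≤ x`, and `e ^ n`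
determines `x` from above with an error of at most `δ`. -/
structure IsScale (V : Set A) (e : A) (δ : ℕ) (N : A → ℕ) : Prop where
  pow_leMod : ∀ x, LeMod V (e ^ N x) x
  le_of_pow_leMod : ∀ x k, LeMod V (e ^ k) x → N x ≤ k
  leMod_pow : ∀ x, LeMod V x (e ^ (N x - δ))

theorem IsMaximalFilter.exists_isScale (hV : IsMaximalFilter V) (hN : IsNormalFilter V)
    (htot : IsLinearFilter V) {u : A} (huV : u ∉ V) (m : ℕ) :
    ∃ (e : A) (δ : ℕ) (N : A → ℕ), IsScale V e δ N ∧ δ * m < N u := by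
  classical
  have hf := hV.isFilter
  have hleast : ∀ e ∉ V, ∃ N : A → ℕ, ∀ x, LeMod V (e ^ N x) x ∧
      ∀ k, LeMod V (e ^ k) x → N x ≤ k := fun e he =>
    ⟨fun x => Nat.find (hV.exists_pow_leMod hN he x), fun x =>
      ⟨Nat.find_spec (hV.exists_pow_leMod hN he x), fun k hk => Nat.find_min' _ hk⟩⟩
  have hone : ∀ x, LeMod V x 1 := fun x => LeMod.of_le hf (le_one_hoop x)
  -- Discrete case: the largest class below `1` has powers hitting every class exactly, so `δ = 0`.
  -- Otherwise `e` can be taken so near `1` that `δ = 1` is negligible.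
  by_cases hd : ∃ e ∉ V, ∀ x ∉ V, LeMod V x e
  · obtain ⟨e, he, hmax⟩ := hd
    obtain ⟨N, hNe⟩ := hleast e he
    refine ⟨e, 0, N, ⟨fun x => (hNe x).1, fun x => (hNe x).2, fun x => ?_⟩, ?_⟩
    · rw [Nat.sub_zero]
      rcases hk : N x with _ | k
      · simpa using hone x
      · have hlt : ¬ LeMod V (e ^ k) x := fun h => by have := (hNe x).2 k h; omega
        rw [pow_succ']
        exact (LeMod.limp_mul hf ((htot _ _).resolve_right hlt)).trans hf
          ((hmax _ hlt).mul hN (LeMod.of_le hf le_rfl))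
    · rw [zero_mul, Nat.pos_iff_ne_zero]
      intro h0
      have h := (hNe u).1
      rw [h0, pow_zero, LeMod, one_limp] at h
      exact huV h
  · push Not at hd
    obtain ⟨e, he, hu⟩ := exists_not_pow_leMod hN htot hd huV m
    obtain ⟨N, hNe⟩ := hleast e he
    refine ⟨e, 1, N, ⟨fun x => (hNe x).1, fun x => (hNe x).2, fun x => ?_⟩, ?_⟩
    · rcases hk : N x with _ | k
      · simpa using hone x
      · rw [Nat.add_sub_cancel]
        exact (htot _ _).resolve_right fun h => by have := (hNe x).2 k h; omega
    · by_contra! h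
      exact hu ((LeMod.of_le hf (pow_anti_hoop e (by omega))).trans hf (hNe u).1)

namespace IsScale

variable {e u : A} {δ : ℕ} {N : A → ℕ}

theorem mul_le (hs : IsScale V e δ N) (hN : IsNormalFilter V) (x y : A) :
    N (x * y) ≤ N x + N y :=
  hs.le_of_pow_leMod _ _ (by rw [pow_add]; exact (hs.pow_leMod x).mul hN (hs.pow_leMod y))

theorem anti (hs : IsScale V e δ N) (hf : IsFilter V) {x y : A} (h : x ≤ y) : N y ≤ N x :=
  hs.le_of_pow_leMod _ _ ((hs.pow_leMod x).le_trans hf h)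

theorem list_prod_le (hs : IsScale V e δ N) (hN : IsNormalFilter V) (l : List A) :
    N l.prod ≤ (l.map N).sum := by
  induction l with
  | nil => exact hs.le_of_pow_leMod _ _ (LeMod.of_le hN.isFilter (le_one_hoop _))
  | cons a l ih =>
    rw [List.prod_cons, List.map_cons, List.sum_cons]
    exact (hs.mul_le hN _ _).trans (by omega)

theorem list_prod_leMod (hs : IsScale V e δ N) (hN : IsNormalFilter V) (l : List A) :
    LeMod V l.prod (e ^ (l.map fun x => N x - δ).sum) := by
  induction l with
  | nil => exact LeMod.of_le hN.isFilter (by simp)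
  | cons a l ih =>
    rw [List.prod_cons, List.map_cons, List.sum_cons, pow_add]
    exact (hs.leMod_pow a).mul hN ih

/-- Replacing `x` by a power of `e` costs `δ`, and powers of `e` commute. -/
theorem limp_le_rimp (hs : IsScale V e δ N) (hN : IsNormalFilter V) (x y : A) :
    N (x ⇾ y) ≤ N (x ⇝ y) + δ := by
  have hf := hN.isFilter
  apply hs.le_of_pow_leMod
  rw [LeMod.limp_iff]
  refine ((LeMod.of_le hf le_rfl).mul hN (hs.leMod_pow x)).trans hf ?_
  rw [← pow_add]
  refine (LeMod.of_le hf (pow_anti_hoop e (m := N x + N (x ⇝ y)) (by omega))).trans hf ?_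
  rw [pow_add]
  exact ((hs.pow_leMod x).mul hN (hs.pow_leMod _)).le_trans hf (mul_rimp_le x y)

theorem rimp_le_limp (hs : IsScale V e δ N) (hN : IsNormalFilter V) (x y : A) :
    N (x ⇝ y) ≤ N (x ⇾ y) + δ := by
  have hf := hN.isFilter
  apply hs.le_of_pow_leMod
  rw [LeMod.rimp_iff hN]
  refine ((hs.leMod_pow x).mul hN (LeMod.of_le hf le_rfl)).trans hf ?_
  rw [← pow_add]
  refine (LeMod.of_le hf (pow_anti_hoop e (m := N (x ⇾ y) + N x) (by omega))).trans hf ?_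
  rw [pow_add]
  exact ((hs.pow_leMod _).mul hN (hs.pow_leMod x)).le_trans hf (limp_mul_le x y)

/-- A product that is small enough at the scale of `V` is below `u` modulo any linear filter
contained in `V`. -/
theorem list_prod_limp_mem (hs : IsScale V e δ N) (hN : IsNormalFilter V) {F : Set A}
    (hF : IsFilter F) (hlin : IsLinearFilter F) (hFV : F ⊆ V) (l : List A)
    (hl : N u < (l.map fun x => N x - δ).sum) : l.prod ⇾ u ∈ F := by
  have hf := hN.isFilter
  induction l with
  | nil => simp at hl
  | cons a l ih =>
    rw [List.map_cons, List.sum_cons] at hl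
    rw [List.prod_cons, mul_limp]
    rcases ha : N a with _ | k
    · exact hF.limp_mem (ih (by omega))
    -- Otherwise `l.prod ⇾ u` is below `a` modulo `F`, hence modulo `V`; but it is already above `e
    -- ^ k`, contradicting the minimality of `N a = k + 1`.
    · refine (hlin _ _).resolve_right fun h => ?_
      have hle : LeMod V (e ^ k) (l.prod ⇾ u) := by
        rw [LeMod.limp_iff]
        refine ((LeMod.of_le hf le_rfl).mul hN (hs.list_prod_leMod hN l)).trans hf ?_
        rw [← pow_add]
        exact (LeMod.of_le hf (pow_anti_hoop e (by omega))).trans hf (hs.pow_leMod u)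
      have := hs.le_of_pow_leMod a k (hle.trans hf (hFV h))
      omega

end IsScale

end LeMod

/-! ### The inequalities from normality -/

theorem sq_limp_le {A : Type*} [BasicPseudoHoop A] {u : A} (hu : IsStrongUnit u)
    (hmax : ∀ V : Set A, IsMaximalFilter V → IsNormalFilter V) (l r : List A)
    (hlr : ∀ (V : Set A) (e : A) (δ : ℕ) (N : A → ℕ), IsNormalFilter V → IsScale V e δ N →
      (l.map N).sum ≤ (r.map N).sum + δ * r.length) :
    (l.prod ⇾ u) ^ 2 ≤ (r.flatMap fun x => [x, x]).prod ⇾ u := by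
  rw [le_limp_iff, le_def]
  by_contra hne
  obtain ⟨F, hF, hlin, hc⟩ := exists_isLinearFilter_notMem hne
  have huF : u ∉ F := fun h => hc (hF.limp_mem h)
  obtain ⟨V, hFV, hV, huV⟩ := hF.exists_isMaximalFilter hu huF
  have hN := hmax V hV
  obtain ⟨e, δ, N, hs, hlarge⟩ := hV.exists_isScale hN
    -- Errors in units of `δ`: two for the factors `l.prod ⇾ u`, `2 * r.length` for the doubled
    -- list, and `2 * r.length` from doubling `hlr`.
    (fun x y => (hlin x y).imp (@hFV _) (@hFV _)) huV (4 * r.length + 2)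
  have h := hs.list_prod_limp_mem hN hF hlin hFV (u := u)
    ((l.prod ⇾ u) :: (l.prod ⇾ u) :: r.flatMap fun x => [x, x])
  rw [List.prod_cons, List.prod_cons, ← mul_assoc, ← pow_two] at h
  refine hc (h ?_)
  have h1 : N u ≤ N (l.prod ⇾ u) + (l.map N).sum :=
    ((hs.anti hV.isFilter (limp_mul_le l.prod u)).trans (hs.mul_le hN _ _)).trans
      (Nat.add_le_add_left (hs.list_prod_le hN l) _)
  have h2 := hlr V e δ N hN hs
  have h3 : ∀ r : List A, 2 * (r.map N).sum ≤
      ((r.flatMap fun x => [x, x]).map fun x => N x - δ).sum + 2 * (δ * r.length) := by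
    intro r
    induction r with
    | nil => simp
    | cons a r ih =>
      simp only [List.flatMap_cons, List.cons_append, List.nil_append, List.map_cons,
        List.sum_cons, List.length_cons, mul_add, mul_one]
      omega
  have h3 := h3 r
  simp only [List.map_cons, List.sum_cons]
  rw [mul_add, mul_left_comm] at hlarge
  omega

section Permutation

theorem flatMap_prod_ofFn {M : Type*} [Monoid M] {n : ℕ} (x : Fin n → M) :
    ((List.ofFn x).flatMap fun a => [a, a]).prod = (List.ofFn fun i => x i ^ 2).prod := by
  induction n with
  | zero => simp
  | succ n ih => simp [List.ofFn_succ, ih, pow_two, mul_assoc]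

theorem flatMap_prod_replicate {M : Type*} [Monoid M] (n : ℕ) (a : M) :
    ((List.replicate n a).flatMap fun a => [a, a]).prod = a ^ (2 * n) := by
  induction n with
  | zero => simp
  | succ n ih =>
    rw [mul_add, add_comm (2 * n), pow_add]
    simp [List.replicate_succ, ih, pow_two, mul_assoc]

theorem exists_perm_ofFn_eq {n : ℕ} {l : List (Fin n)} (h : l.Perm (List.finRange n)) :
    ∃ π : Equiv.Perm (Fin n), List.ofFn π = l := by
  have hlen : l.length = n := by simpa using h.length_eq
  refine ⟨(finCongr hlen.symm).trans (List.Nodup.getEquivOfForallMemList l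
    (h.nodup_iff.2 (List.nodup_finRange n)) fun x => h.mem_iff.2 (List.mem_finRange x)), ?_⟩
  apply List.ext_getElem
  · simp [hlen]
  · intro i h1 h2
    simp

end Permutation


/-! ### Normality from the inequalities -/

section Converse

variable {A : Type*} [PseudoHoop A] {V : Set A} {u : A}

theorem IsMaximalFilter.notMem (hV : IsMaximalFilter V) (hu : IsStrongUnit u) : u ∉ V :=
  fun h => hV.ne_univ (hu.eq_univ hV.isFilter h)

/-- Without normality the copies of `b` cannot be moved past elements of `V`, hence arbitrary
interleaved words. -/
theorem IsMaximalFilter.exists_list_prod_le (hV : IsMaximalFilter V) {b : A} (hb : b ∉ V) (z : A) :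
    ∃ l : List A, (∀ x ∈ l, x ∈ V ∨ x = b) ∧ l.prod ≤ z := by
  have hG : IsFilter {z : A | ∃ l : List A, (∀ x ∈ l, x ∈ V ∨ x = b) ∧ l.prod ≤ z} := by
    refine ⟨⟨1, [], by simp, by simp⟩, ?_, ?_⟩
    · rintro x y ⟨l, hl, hlx⟩ ⟨l', hl', hly⟩
      refine ⟨l ++ l', fun w hw => ?_, ?_⟩
      · exact (List.mem_append.1 hw).elim (hl w) (hl' w)
      · rw [List.prod_append]
        exact mul_le_mul' hlx hly
    · rintro x y hxy ⟨l, hl, hlx⟩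
      exact ⟨l, hl, hlx.trans hxy⟩
  by_contra hz
  refine hV.not_ssubset _ hG (fun h => hz (Set.eq_univ_iff_forall.1 h z)) ⟨fun x hx => ?_, fun h => ?_⟩
  · exact ⟨[x], by simpa using Or.inl hx, by simp⟩
  · exact hb (h ⟨[b], by simp, by simp⟩)

theorem IsMaximalFilter.exists_pow_limp_mem (hV : IsMaximalFilter V)
    (hperm : ∀ (n : ℕ) (x : Fin n → A) (π : Equiv.Perm (Fin n)),
      ((List.ofFn x).prod ⇾ u) ^ 2 ≤ (List.ofFn fun i => x (π i) ^ 2).prod ⇾ u)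
    {b : A} (hb : b ∉ V) : ∃ n : ℕ, b ^ (2 * n) ⇾ u ∈ V := by
  classical
  obtain ⟨l, hl, hlu⟩ := hV.exists_list_prod_le hb u
  -- `π` lists the positions of entries in `V` first, then those of `b`.
  obtain ⟨π, hπ⟩ := exists_perm_ofFn_eq
    (List.filter_append_perm (fun i => decide (l.get i ∈ V)) (List.finRange l.length))
  have h := hperm l.length l.get π
  have hofFn : (List.ofFn fun i => l.get (π i) ^ 2) =
      (List.ofFn π).map fun j => l.get j ^ 2 := by
    rw [List.map_ofFn]; rfl
  rw [List.ofFn_get, le_def.1 hlu, one_pow, one_le_iff, hofFn, hπ, List.map_append,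
    List.prod_append, mul_limp] at h
  rw [List.prod_eq_pow_card (m := b ^ 2) (l := List.map _ (List.filter (fun _ => !_) _)) (by
    intro x hx
    simp only [List.mem_map, List.mem_filter] at hx
    obtain ⟨i, ⟨-, hi⟩, rfl⟩ := hx
    rw [(hl _ (l.get_mem i)).resolve_left (by simpa using hi)]), ← pow_mul] at h
  refine ⟨_, hV.isFilter.mem_of_le _ _ (le_def.2 h) (hV.isFilter.list_prod_mem fun x hx => ?_)⟩
  simp only [List.mem_map, List.mem_filter] at hx
  obtain ⟨i, ⟨-, hi⟩, rfl⟩ := hx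
  exact hV.isFilter.pow_mem (by simpa using hi) 2

theorem IsMaximalFilter.mem_of_sq_limp_le (hV : IsMaximalFilter V) (hu : IsStrongUnit u)
    (hperm : ∀ (n : ℕ) (x : Fin n → A) (π : Equiv.Perm (Fin n)),
      ((List.ofFn x).prod ⇾ u) ^ 2 ≤ (List.ofFn fun i => x (π i) ^ 2).prod ⇾ u)
    {a b : A} (hab : ∀ n : ℕ, (b ^ n ⇾ u) ^ 2 ≤ a ^ (2 * n) ⇾ u) (ha : a ∈ V) : b ∈ V := by
  have hf := hV.isFilter
  by_contra hb
  obtain ⟨n, hn⟩ := hV.exists_pow_limp_mem hperm hb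
  exact hV.notMem hu (hf.mp (hf.mem_of_le _ _ (hab (2 * n)) (hf.pow_mem hn 2)) (hf.pow_mem ha _))

end Converse

end PseudoHoop

theorem theorem4p5 {A : Type*} [BasicPseudoHoop A] (u : A) (hu : PseudoHoop.IsStrongUnit u) :
    (∀ V : Set A, PseudoHoop.IsMaximalFilter V → PseudoHoop.IsNormalFilter V) ↔
      (∀ (n : ℕ) (x : Fin n → A) (π : Equiv.Perm (Fin n)),
          ((List.ofFn x).prod ⇾ u) ^ 2 ≤ (List.ofFn fun i => x (π i) ^ 2).prod ⇾ u) ∧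
      (∀ (n : ℕ) (x y : A), ((x ⇾ y) ^ n ⇾ u) ^ 2 ≤ (x ⇝ y) ^ (2 * n) ⇾ u) ∧
      (∀ (n : ℕ) (x y : A), ((x ⇝ y) ^ n ⇾ u) ^ 2 ≤ (x ⇾ y) ^ (2 * n) ⇾ u) := by
  constructor
  · intro hmax
    have hrep : ∀ (n : ℕ) (a b : A), (∀ (V : Set A) (e : A) (δ : ℕ) (N : A → ℕ),
        PseudoHoop.IsNormalFilter V → PseudoHoop.IsScale V e δ N → N a ≤ N b + δ) →
        (a ^ n ⇾ u) ^ 2 ≤ b ^ (2 * n) ⇾ u := by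
      intro n a b hab
      rw [← PseudoHoop.flatMap_prod_replicate, ← List.prod_replicate n a]
      refine PseudoHoop.sq_limp_le hu hmax _ _ fun V e δ N hN hs => ?_
      have h := Nat.mul_le_mul_left n (hab V e δ N hN hs)
      simpa [mul_add, mul_comm] using h
    refine ⟨fun n x π => ?_, fun n x y => ?_, fun n x y => ?_⟩
    · rw [← PseudoHoop.flatMap_prod_ofFn fun i => x (π i)]
      refine PseudoHoop.sq_limp_le hu hmax _ _ fun V e δ N _ _ => ?_
      exact le_add_right ((π.ofFn_comp_perm x).map N).sum_eq.ge
    · exact hrep n _ _ fun V e δ N hN hs => hs.limp_le_rimp hN x y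
    · exact hrep n _ _ fun V e δ N hN hs => hs.rimp_le_limp hN x y
  · rintro ⟨h1, h2, h3⟩ V hV
    exact ⟨hV.isFilter, fun x y => ⟨hV.mem_of_sq_limp_le hu h1 fun n => h3 n x y,
      hV.mem_of_sq_limp_le hu h1 fun n => h2 n x y⟩⟩
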